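/- Let $X$ be a real Banach space. For a family $(x_\alpha)$ in $X$ write $[x_\alpha:\alpha\in S]$ for the closed linear span of $\{x_\alpha:\alpha\in S\}$. Let $\kappa$ be an uncountable regular cardinal and let $(x_\alpha)_{\alpha<\kappa}$ be a sequence in $X$ with $\|x_\alpha\|=1$ for all $\alpha<\kappa$. Subsequences $(x_{\alpha_\sigma})_{\sigma<\kappa}$ are always taken along strictly increasing maps $\sigma\mapsto\alpha_\sigma$ from $\kappa$ to $\kappa$. Definitions. * $(x_\alpha)_{\alpha<\kappa}$ is *weakly null* if $x_\alpha\to 0$ in the weak topology of $X$ as $\alpha\to\kappa$. * $(x_\alpha)_{\alpha<\kappa}$ is *dispersed* if $\bigcap_{\gamma<\kappa}[x_\alpha:\gamma<\alpha<\kappa]\subsetneq[x_\alpha:\beta<\alpha<\kappa]$ for every $\beta<\kappa$, and *strongly dispersed* if moreover $\bigcap_{\beta<\kappa}[x_\alpha:\beta<\alpha<\kappa]=\{0\}$. * For a limit ordinal $\theta$, a sequence $(e_\alpha)_{\alpha<\theta}$ of nonzero vectors is a *monotone basic sequence* if $\|y\|\le\|y+z\|$ for all $\mu<\theta$, all $y\in[e_\alpha:\alpha<\mu]$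 and all $z\in[e_\alpha:\mu\le\alpha<\theta]$. * $(e_\alpha)_{\alpha<\theta}$ is a *bounded biorthogonal sequence* if there are $e_\alpha^*\in X^*$ with $e_\alpha^*(e_\beta)=\delta_{\alpha,\beta}$ and $\sup_\alpha\|e_\alpha\|\,\|e_\alpha^*\|<\infty$. * $X$ has *Corson's property (C)* if every family of closed convex subsets of $X$ with empty intersection has a countable subfamily with empty intersection. * $X$ is a *Plichko space* if there are an index set $\Gamma$ and families $(x_\gamma)_{\gamma\in\Gamma}$ in $X$, $(x^*_\gamma)_{\gamma\in\Gamma}$ in $X^*$ such that $x_\gamma^*(x_\delta)=\delta_{\gamma,\delta}$, the linear span of the $x_\gamma$ is norm dense in $X$, the linear span of the $x_\gamma^*$ is weak$^*$ dense in $X^*$, and the subspace $Y=\{f\in X^*: f(x_\gamma)\ne0\text{ for at most countably many }\gamma\}$ is $1$-norming, i.e. $\sup\{f(x): f\in Y,\ \|f\|=1\}\ge 1$ for every $x\in X$ with $\|x\|=1$. Theorem. 1. If $(x_\alpha)_{\alpha<\kappa}$ is weakly null, then it has a subsequence $(x_{\alpha_\sigma})_{\sigma<\kappa}$ which is a monotone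 basic sequence. 2. If $X$ has Corson's property (C) and $(x_\alpha)_{\alpha<\kappa}$ is dispersed, then it has a subsequence $(x_{\alpha_\sigma})_{\sigma<\kappa}$ which is a bounded biorthogonal sequence. If $X$ has Corson's property (C) and $(x_\alpha)_{\alpha<\kappa}$ is strongly dispersed, then it has a subsequence $(x_{\alpha_\sigma})_{\sigma<\kappa}$ which is a monotone basic sequence. Moreover, every nonseparable Plichko space contains an uncountable monotone basic sequence, i.e. a monotone basic sequence $(e_\alpha)_{\alpha<\theta}$ for some uncountable limit ordinal $\theta$. -/

import Mathlib

open scoped Cardinal Topology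

universe u v

/-- The closed linear span `[x_α : α ∈ S]`. -/
def closedSpan {X I : Type*} [NormedAddCommGroup X] [NormedSpace ℝ X]
    (x : I → X) (S : Set I) : Submodule ℝ X :=
  (Submodule.span ℝ (x '' S)).topologicalClosure

/-- The family `(x_α)` tends to `0` in the weak topology of `X` as `α` increases. -/
def IsWeaklyNull {X I : Type*} [NormedAddCommGroup X] [NormedSpace ℝ X] [LinearOrder I]
    (x : I → X) : Prop :=
  Filter.Tendsto (fun α => toWeakSpace ℝ X (x α)) Filter.atTop (𝓝 0)

/-- `⋂_γ [x_α : γ < α]` is a proper subspace of `[x_α : β < α]` for every `β`. -/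
def IsDispersed {X I : Type*} [NormedAddCommGroup X] [NormedSpace ℝ X] [LinearOrder I]
    (x : I → X) : Prop :=
  ∀ β : I, (⨅ γ : I, closedSpan x (Set.Ioi γ)) < closedSpan x (Set.Ioi β)

/-- Dispersed, and `⋂_β [x_α : β < α] = {0}`. -/
def IsStronglyDispersed {X I : Type*} [NormedAddCommGroup X] [NormedSpace ℝ X] [LinearOrder I]
    (x : I → X) : Prop :=
  IsDispersed x ∧ (⨅ β : I, closedSpan x (Set.Ioi β)) = ⊥

/-- A (transfinite) basic sequence with basis constant at most `C`: the vectors are nonzero and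
`‖y‖ ≤ C ‖y + z‖` for `y ∈ [x_α : α < μ]`, `z ∈ [x_α : μ ≤ α]` and every index `μ`. -/
def IsBasicSequenceWith {X I : Type*} [NormedAddCommGroup X] [NormedSpace ℝ X] [LinearOrder I]
    (C : ℝ) (x : I → X) : Prop :=
  (∀ α, x α ≠ 0) ∧
    ∀ μ : I, ∀ y ∈ closedSpan x (Set.Iio μ), ∀ z ∈ closedSpan x (Set.Ici μ),
      ‖y‖ ≤ C * ‖y + z‖

/-- A monotone basic sequence: the basis constant is `1`. -/
def IsMonotoneBasicSequence {X I : Type*} [NormedAddCommGroup X] [NormedSpace ℝ X] [LinearOrder I]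
    (x : I → X) : Prop :=
  IsBasicSequenceWith 1 x

/-- `(x_α, f_α)` is a biorthogonal system: `f_α (x_α) = 1` and `f_α (x_β) = 0` for `α ≠ β`. -/
def IsBiorthogonalSystem {X I : Type*} [NormedAddCommGroup X] [NormedSpace ℝ X]
    (x : I → X) (f : I → StrongDual ℝ X) : Prop :=
  (∀ α, f α (x α) = 1) ∧ ∀ α β, α ≠ β → f α (x β) = 0

/-- There are functionals `f_α` forming with `(x_α)` a biorthogonal system such that
`sup_α ‖x_α‖ ‖f_α‖ < ∞`. -/
def IsBoundedBiorthogonalSequence {X I : Type*} [NormedAddCommGroup X] [NormedSpace ℝ X]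
    (x : I → X) : Prop :=
  ∃ f : I → StrongDual ℝ X, IsBiorthogonalSystem x f ∧ ∃ C : ℝ, ∀ α, ‖x α‖ * ‖f α‖ ≤ C

/-- Corson's property (C): every family of closed convex sets with empty intersection has a
countable subfamily with empty intersection. -/
def CorsonPropertyC (X : Type*) [NormedAddCommGroup X] [NormedSpace ℝ X] : Prop :=
  ∀ F : Set (Set X), (∀ s ∈ F, IsClosed s ∧ Convex ℝ s) → ⋂₀ F = ∅ →
    ∃ G ⊆ F, G.Countable ∧ ⋂₀ G = ∅

/-- A Markushevich basis: a biorthogonal system whose vectors have dense span and whose functionals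
have weak-star dense span. -/
def IsMBasis {X I : Type*} [NormedAddCommGroup X] [NormedSpace ℝ X]
    (x : I → X) (f : I → StrongDual ℝ X) : Prop :=
  IsBiorthogonalSystem x f ∧ closedSpan x Set.univ = ⊤ ∧
    closure (StrongDual.toWeakDual '' (Submodule.span ℝ (Set.range f) : Set (StrongDual ℝ X))) =
      Set.univ

/-- The subspace of functionals `f` such that `f (x_α) ≠ 0` for at most countably many `α`. -/
def countablySupportedFunctionals {X I : Type*} [NormedAddCommGroup X] [NormedSpace ℝ X]
    (x : I → X) : Submodule ℝ (StrongDual ℝ X) where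
  carrier := {f | {α | f (x α) ≠ 0}.Countable}
  zero_mem' := by simp
  add_mem' := by
    intro f g hf hg
    refine (hf.union hg).mono ?_
    intro α hα
    by_contra h
    simp only [Set.mem_union, Set.mem_ofPred_eq, not_or, not_not] at h
    exact hα (by simp [h.1, h.2])
  smul_mem' := by
    intro c f hf
    refine hf.mono ?_
    intro α hα h
    exact hα (by simp [h])

/-- `Y` is an `r`-norming subspace of the dual:
`sup {f x : f ∈ Y, ‖f‖ = 1} ≥ r` for every unit vector `x`. -/
def IsNormingSubspace {X : Type*} [NormedAddCommGroup X] [NormedSpace ℝ X]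
    (r : ℝ) (Y : Submodule ℝ (StrongDual ℝ X)) : Prop :=
  ∀ x : X, ‖x‖ = 1 → ∀ s < r, ∃ f ∈ Y, ‖f‖ = 1 ∧ s < f x

/-- A Plichko space: one that admits a countably `1`-norming Markushevich basis. Since the vectors
of such a basis are distinct, index types in the universe of `X` suffice. -/
def IsPlichko (X : Type u) [NormedAddCommGroup X] [NormedSpace ℝ X] : Prop :=
  ∃ (I : Type u) (x : I → X) (f : I → StrongDual ℝ X),
    IsMBasis x f ∧ IsNormingSubspace 1 (countablySupportedFunctionals x)

/-!
All four assertions rest on one criterion. Over an index set whose order type is an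
uncountable regular cardinal, call `(x_α)` *eventually orthogonal* if every `y` and every `r < ‖y‖`
admit a tail of the sequence with `r ≤ ‖y + z‖` for all `z` in its closed span. Countable sets of
indices are bounded, so one tail serves all `r < ‖y‖` at once, and even all `y` in a separable set;
fewer than `κ` indices are bounded, so one tail serves the closed span of fewer than `κ` of the
vectors, the closure of the union of the spans of the finite subfamilies. Transfinite recursion
then selects a monotone basic subsequence (`IsEventuallyOrthogonal.exists_monotoneBasicSequence`).

The criterion is verified as follows.
* A functional `f` with `f x_α → 0` vanishes at `x_α` on a tail, since `κ` has uncountable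
  cofinality. For weakly null `(x_α)` apply this to a functional norming `y`; in a Plichko space
  apply the countable support to a functional of the norming subspace that almost norms `y`, the
  sequence being any `ω₁` of the vectors of the Markushevich basis.
* If the closed spans of the tails intersect in `{0}`, their intersections with a ball of radius
  `r < ‖y‖` about `y` have no common point. By property (C) neither have countably many of them,
  and these all contain the one of a later tail, which is thus empty.

A merely dispersed sequence becomes strongly dispersed in the quotient by the intersection `Z` of
the closed spans of the tails. Uncountable cofinality gives a lower bound for the norms of
cofinally many of the images, among which a monotone basic subsequence is chosen; its biorthogonal
functionals, composed with the quotient map, are uniformly bounded.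
-/

open Set Filter Order Cardinal

/-! ### Index sets of uncountable regular order type -/

section RegularOrder

variable {I : Type*} [LinearOrder I] [WellFoundedLT I] [IsRegularCardinalOrder I]

theorem exists_forall_lt_of_mk_lt {s : Set I} (hs : #s < #I) : ∃ b, ∀ a ∈ s, a < b := by
  rw [← not_isCofinal_iff]
  intro h
  have := Order.cof_le h
  rw [cof_eq_cardinalMk] at this
  exact this.not_gt hs

theorem Set.Countable.exists_forall_lt (hI : ℵ₀ < #I) {s : Set I} (hs : s.Countable) :
    ∃ b, ∀ a ∈ s, a < b :=
  exists_forall_lt_of_mk_lt (hs.le_aleph0.trans_lt hI)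

theorem noMaxOrder_of_aleph0_lt_mk (hI : ℵ₀ < #I) : NoMaxOrder I where
  exists_gt a := by
    obtain ⟨b, hb⟩ := (countable_singleton a).exists_forall_lt hI
    exact ⟨b, hb a rfl⟩

theorem exists_forall_ge_of_countable (hI : ℵ₀ < #I) {ι : Type*} [Countable ι]
    {P : ι → I → Prop} (h : ∀ i, ∃ γ, ∀ α, γ ≤ α → P i α) :
    ∃ γ, ∀ α, γ ≤ α → ∀ i, P i α := by
  choose γ hγ using h
  obtain ⟨b, hb⟩ := (countable_range γ).exists_forall_lt hI
  exact ⟨b, fun α hα i => hγ i α ((hb _ ⟨i, rfl⟩).le.trans hα)⟩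

theorem exists_forall_ge_eq_zero (hI : ℵ₀ < #I) {u : I → ℝ}
    (hu : ∀ ε > 0, ∃ γ, ∀ α, γ ≤ α → |u α| < ε) : ∃ γ, ∀ α, γ ≤ α → u α = 0 := by
  obtain ⟨γ, hγ⟩ := exists_forall_ge_of_countable hI
    fun n : ℕ => hu (1 / ((n : ℝ) + 1)) Nat.one_div_pos_of_nat
  refine ⟨γ, fun α hα => ?_⟩
  by_contra hne
  obtain ⟨n, hn⟩ := exists_nat_one_div_lt (abs_pos.2 hne)
  exact (hγ α hα n).not_gt hn

/-- Transfinite recursion: a relation that can be satisfied over each set of fewer than `#I`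
indices is satisfied along some sequence, at each place over the set of the earlier terms. -/
theorem exists_forall_rel_image_Iio {R : Set I → I → Prop}
    (hR : ∀ A : Set I, #A < #I → ∃ b, R A b) :
    ∃ φ : I → I, ∀ σ, R (φ '' Iio σ) (φ σ) := by
  classical
  rcases isEmpty_or_nonempty I with hI | hI
  · exact ⟨id, fun σ => hI.elim σ⟩
  have hR' : ∀ A : Set I, ∃ b, #A < #I → R A b := fun A => by
    by_cases hA : #A < #I
    · exact (hR A hA).imp fun b hb _ => hb
    · exact ⟨hI.some, fun h => absurd h hA⟩
  choose G hG using hR'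
  let F : ∀ σ : I, (∀ τ, τ < σ → I) → I := fun σ ih => G {b | ∃ τ, ∃ h : τ < σ, ih τ h = b}
  let φ : I → I := wellFounded_lt.fix F
  have hφ : ∀ σ, φ σ = G (φ '' Iio σ) := fun σ => by
    have h := wellFounded_lt.fix_eq F σ
    have hset : {b | ∃ τ, ∃ _ : τ < σ, φ τ = b} = φ '' Iio σ := by
      ext b
      simp
    rw [← hset]
    exact h
  refine ⟨φ, fun σ => ?_⟩
  rw [hφ σ]
  refine hG _ (mk_image_le.trans_lt (mk_Iio_lt σ ?_))
  rw [← ord_cof_eq_type_lt, cof_eq_cardinalMk]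

end RegularOrder

theorem Cardinal.IsRegular.isRegularCardinalOrder_Iio_ord {κ : Cardinal.{v}} (hκ : κ.IsRegular) :
    IsRegularCardinalOrder (Set.Iio κ.ord) where
  type_lt_le_ord_cof := by
    simp [hκ.lift.cof_ord]

theorem Cardinal.aleph0_lt_mk_Iio_ord {κ : Cardinal.{v}} (hκ : ℵ₀ < κ) :
    ℵ₀ < #(Set.Iio κ.ord) := by
  simpa [mk_Iio_ordinal] using hκ

/-! ### Closed linear spans -/

section ClosedSpan

variable {X : Type*} [NormedAddCommGroup X] [NormedSpace ℝ X] {I : Type*}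

theorem closedSpan_mono (x : I → X) {S T : Set I} (h : S ⊆ T) :
    closedSpan x S ≤ closedSpan x T :=
  Submodule.topologicalClosure_mono (Submodule.span_mono (image_mono h))

theorem span_le_closedSpan (x : I → X) (S : Set I) :
    Submodule.span ℝ (x '' S) ≤ closedSpan x S :=
  Submodule.le_topologicalClosure _

theorem mem_closedSpan (x : I → X) {S : Set I} {α : I} (h : α ∈ S) : x α ∈ closedSpan x S :=
  span_le_closedSpan x S (Submodule.subset_span (mem_image_of_mem x h))

theorem isClosed_closedSpan (x : I → X) (S : Set I) : IsClosed (closedSpan x S : Set X) :=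
  Submodule.isClosed_topologicalClosure _

theorem closedSpan_le {x : I → X} {S : Set I} {M : Submodule ℝ X} (hM : IsClosed (M : Set X))
    (h : ∀ α ∈ S, x α ∈ M) : closedSpan x S ≤ M :=
  Submodule.topologicalClosure_minimal _
    (Submodule.span_le.2 (by rintro _ ⟨α, hα, rfl⟩; exact h α hα)) hM

theorem closedSpan_comp (x : I → X) {J : Type*} (φ : J → I) (S : Set J) :
    closedSpan (x ∘ φ) S = closedSpan x (φ '' S) := by
  simp only [closedSpan, image_comp]

theorem apply_le_norm_add {x : I → X} {S : Set I} {f : StrongDual ℝ X} (hf : ‖f‖ ≤ 1)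
    (h : ∀ α ∈ S, f (x α) = 0) (y : X) {z : X} (hz : z ∈ closedSpan x S) : f y ≤ ‖y + z‖ := by
  have hz0 : f z = 0 := closedSpan_le (M := f.ker) f.isClosed_ker h hz
  calc f y = f (y + z) := by rw [map_add, hz0, add_zero]
    _ ≤ ‖f (y + z)‖ := le_abs_self _
    _ ≤ ‖y + z‖ := by simpa using f.le_of_opNorm_le hf (y + z)

end ClosedSpan

/-! ### Eventually orthogonal sequences -/

section EventuallyOrthogonal

variable {X : Type*} [NormedAddCommGroup X] [NormedSpace ℝ X] {I : Type*} [LinearOrder I]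

/-- Each vector `y` is almost orthogonal, in the sense of Birkhoff and James, to the closed spans
of the tails of the sequence: `‖y + z‖` is at least any given `r < ‖y‖` for all `z` in some tail. -/
def IsEventuallyOrthogonal (x : I → X) : Prop :=
  ∀ y : X, ∀ r < ‖y‖, ∃ γ, ∀ z ∈ closedSpan x (Ici γ), r ≤ ‖y + z‖

variable [WellFoundedLT I] [IsRegularCardinalOrder I]

theorem IsEventuallyOrthogonal.exists_norm_le {x : I → X} (hx : IsEventuallyOrthogonal x)
    (hI : ℵ₀ < #I) (y : X) : ∃ γ, ∀ z ∈ closedSpan x (Ici γ), ‖y‖ ≤ ‖y + z‖ := by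
  have h : ∀ n : ℕ, ∃ γ, ∀ α, γ ≤ α → ∀ z ∈ closedSpan x (Ici α),
      ‖y‖ - 1 / ((n : ℝ) + 1) ≤ ‖y + z‖ := fun n => by
    obtain ⟨γ, hγ⟩ := hx y (‖y‖ - 1 / ((n : ℝ) + 1)) (sub_lt_self _ Nat.one_div_pos_of_nat)
    exact ⟨γ, fun α hα z hz => hγ z (closedSpan_mono x (Ici_subset_Ici.2 hα) hz)⟩
  obtain ⟨γ, hγ⟩ := exists_forall_ge_of_countable hI h
  refine ⟨γ, fun z hz => le_of_forall_pos_le_add fun ε hε => ?_⟩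
  obtain ⟨n, hn⟩ := exists_nat_one_div_lt hε
  linarith [hγ γ le_rfl n z hz]

theorem IsEventuallyOrthogonal.exists_norm_le_of_isSeparable {x : I → X}
    (hx : IsEventuallyOrthogonal x) (hI : ℵ₀ < #I) {T : Set X}
    (hT : TopologicalSpace.IsSeparable T) :
    ∃ γ, ∀ y ∈ T, ∀ z ∈ closedSpan x (Ici γ), ‖y‖ ≤ ‖y + z‖ := by
  obtain ⟨c, hc, hTc⟩ := hT
  have := hc.to_subtype
  have h : ∀ y : c, ∃ γ, ∀ α, γ ≤ α → ∀ z ∈ closedSpan x (Ici α), ‖(y : X)‖ ≤ ‖(y : X) + z‖ :=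
    fun y => by
      obtain ⟨γ, hγ⟩ := hx.exists_norm_le hI (y : X)
      exact ⟨γ, fun α hα z hz => hγ z (closedSpan_mono x (Ici_subset_Ici.2 hα) hz)⟩
  obtain ⟨γ, hγ⟩ := exists_forall_ge_of_countable hI h
  refine ⟨γ, fun y hy z hz => ?_⟩
  have hcl : IsClosed {y : X | ‖y‖ ≤ ‖y + z‖} := isClosed_le (by fun_prop) (by fun_prop)
  exact closure_minimal (fun w hw => hγ γ le_rfl ⟨w, hw⟩ z hz) hcl (hTc hy)

theorem IsEventuallyOrthogonal.exists_norm_le_of_mk_lt {x : I → X}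
    (hx : IsEventuallyOrthogonal x) (hI : ℵ₀ < #I) {A : Set I} (hA : #A < #I) :
    ∃ γ, ∀ y ∈ closedSpan x A, ∀ z ∈ closedSpan x (Ici γ), ‖y‖ ≤ ‖y + z‖ := by
  classical
  have h : ∀ s : Finset A, ∃ γ,
      ∀ y ∈ (Submodule.span ℝ ((fun a : A => x a) '' s) : Set X),
        ∀ z ∈ closedSpan x (Ici γ), ‖y‖ ≤ ‖y + z‖ := fun s =>
    hx.exists_norm_le_of_isSeparable hI (s.finite_toSet.image _).countable.isSeparable.span
  choose g hg using h
  have hfin : #(Finset A) < #I := by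
    rcases finite_or_infinite A with h | h
    · exact (mk_lt_aleph0 (α := Finset A)).trans hI
    · rwa [mk_finset_of_infinite]
  obtain ⟨γ, hγ⟩ := exists_forall_lt_of_mk_lt ((mk_range_le (f := g)).trans_lt hfin)
  refine ⟨γ, fun y hy z hz => ?_⟩
  have hcl : IsClosed {y : X | ‖y‖ ≤ ‖y + z‖} := isClosed_le (by fun_prop) (by fun_prop)
  refine closure_minimal (fun w hw => ?_) hcl hy
  obtain ⟨T, hT, hwT⟩ := Submodule.mem_span_finite_of_mem_span hw
  obtain ⟨s, -, rfl⟩ := (Finset.subset_set_image_iff (s := univ) (f := fun a : A => x a)).1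
    (hT.trans (by rw [image_univ, image_eq_range]))
  rw [Finset.coe_image] at hwT
  exact hg s w hwT z (closedSpan_mono x (Ici_subset_Ici.2 (hγ _ ⟨s, rfl⟩).le) hz)

theorem IsEventuallyOrthogonal.exists_monotoneBasicSequence {x : I → X}
    (hx : IsEventuallyOrthogonal x) (hI : ℵ₀ < #I) {S : Set I} (hS : IsCofinal S)
    (hne : ∀ α ∈ S, x α ≠ 0) :
    ∃ φ : I → I, StrictMono φ ∧ (∀ σ, φ σ ∈ S) ∧ IsMonotoneBasicSequence (x ∘ φ) := by
  obtain ⟨φ, hφ⟩ := exists_forall_rel_image_Iio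
    (R := fun A b => (∀ a ∈ A, a < b) ∧ b ∈ S ∧
      ∀ y ∈ closedSpan x A, ∀ z ∈ closedSpan x (Ici b), ‖y‖ ≤ ‖y + z‖) fun A hA => by
    obtain ⟨b, hb⟩ := exists_forall_lt_of_mk_lt hA
    obtain ⟨γ, hγ⟩ := hx.exists_norm_le_of_mk_lt hI hA
    obtain ⟨c, hcS, hc⟩ := hS (max b γ)
    refine ⟨c, fun a ha => (hb a ha).trans_le ((le_max_left _ _).trans hc), hcS,
      fun y hy z hz => hγ y hy z ?_⟩
    exact closedSpan_mono x (Ici_subset_Ici.2 ((le_max_right _ _).trans hc)) hz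
  have hmono : StrictMono φ := fun τ σ h => (hφ σ).1 _ (mem_image_of_mem φ h)
  refine ⟨φ, hmono, fun σ => (hφ σ).2.1, fun σ => hne _ (hφ σ).2.1, fun μ y hy z hz => ?_⟩
  rw [closedSpan_comp] at hy hz
  rw [one_mul]
  refine (hφ μ).2.2 y hy z (closedSpan_mono x ?_ hz)
  rintro _ ⟨τ, hτ, rfl⟩
  exact hmono.monotone hτ

end EventuallyOrthogonal

/-! ### Weakly null sequences -/

section WeaklyNull

variable {X : Type*} [NormedAddCommGroup X] [NormedSpace ℝ X] {I : Type*} [LinearOrder I]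

theorem IsWeaklyNull.tendsto_apply {x : I → X} (hx : IsWeaklyNull x) (f : StrongDual ℝ X) :
    Tendsto (fun α => f (x α)) atTop (𝓝 0) := by
  have hc : Continuous fun w : WeakSpace ℝ X => f ((toWeakSpace ℝ X).symm w) :=
    WeakBilin.eval_continuous (topDualPairing ℝ X).flip f
  have h := (hc.tendsto 0).comp hx
  simpa [Function.comp_def] using h

variable [WellFoundedLT I] [IsRegularCardinalOrder I]

theorem IsWeaklyNull.isEventuallyOrthogonal (hI : ℵ₀ < #I) {x : I → X} (hx : IsWeaklyNull x) :
    IsEventuallyOrthogonal x := fun y r hr => by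
  obtain ⟨f, hf, hfy⟩ := exists_dual_vector'' ℝ y
  have : Nonempty I := mk_ne_zero_iff.1 (aleph0_pos.trans hI).ne'
  obtain ⟨γ, hγ⟩ := exists_forall_ge_eq_zero hI (u := fun α => f (x α)) fun ε hε => by
    have := Metric.tendsto_nhds.1 (hx.tendsto_apply f) ε hε
    simpa [Real.dist_eq] using eventually_atTop.1 this
  have hfy' : f y = ‖y‖ := by simpa using hfy
  exact ⟨γ, fun z hz => by linarith [apply_le_norm_add hf hγ y hz]⟩

end WeaklyNull

/-! ### Property (C) -/

section Corson

variable {X : Type*} [NormedAddCommGroup X] [NormedSpace ℝ X] {I : Type*} [LinearOrder I]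

theorem CorsonPropertyC.quotient (hC : CorsonPropertyC X) (Z : Submodule ℝ X)
    [IsClosed (Z : Set X)] : CorsonPropertyC (X ⧸ Z) := by
  intro F hF hFe
  obtain ⟨G, hGF, hG, hGe⟩ := hC ((fun s => Z.mkQL ⁻¹' s) '' F) (by
    rintro _ ⟨s, hs, rfl⟩
    exact ⟨(hF s hs).1.preimage Z.mkQL.continuous,
      (hF s hs).2.linear_preimage (Z.mkQL : X →ₗ[ℝ] X ⧸ Z)⟩) (by
    rw [sInter_image, ← preimage_iInter₂, ← sInter_eq_biInter, hFe, preimage_empty])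
  obtain ⟨G', hG'F, hbij⟩ := SurjOn.exists_bijOn_subset (f := fun s => Z.mkQL ⁻¹' s) hGF
  refine ⟨G', hG'F, ?_, ?_⟩
  · exact hbij.mapsTo.countable_of_injOn hbij.injOn hG
  · rw [← hbij.image_eq, sInter_image, ← preimage_iInter₂, ← sInter_eq_biInter] at hGe
    exact (Z.mkQ_surjective.preimage_injective) (by simpa using hGe)

variable [WellFoundedLT I] [IsRegularCardinalOrder I]

theorem CorsonPropertyC.isEventuallyOrthogonal (hC : CorsonPropertyC X) (hI : ℵ₀ < #I)
    {x : I → X} (hx : (⨅ γ : I, closedSpan x (Ioi γ)) = ⊥) : IsEventuallyOrthogonal x := by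
  intro y r hr
  have : Nonempty I := mk_ne_zero_iff.1 (aleph0_pos.trans hI).ne'
  let C : I → Set X := fun γ => Metric.closedBall y r ∩ closedSpan x (Ioi γ)
  have hCe : ⋂₀ range C = ∅ := by
    refine eq_empty_of_forall_notMem fun z hz => ?_
    rw [sInter_range, mem_iInter] at hz
    have hz0 : z ∈ (⨅ γ : I, closedSpan x (Ioi γ)) := (Submodule.mem_iInf _).2 fun γ => (hz γ).2
    rw [hx, Submodule.mem_bot] at hz0
    have := (hz (Classical.arbitrary I)).1
    rw [hz0, Metric.mem_closedBall, dist_zero_left] at this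
    exact this.not_gt hr
  obtain ⟨G, hG, hGc, hGe⟩ := hC (range C) (by
    rintro _ ⟨γ, rfl⟩
    exact ⟨Metric.isClosed_closedBall.inter (isClosed_closedSpan x _),
      (convex_closedBall _ _).inter (Submodule.convex _)⟩) hCe
  -- The countably many sets in `G` all contain the one attached to a bound `γ` of their indices.
  choose! g hg using hG
  obtain ⟨γ, hγ⟩ := (hGc.image g).exists_forall_lt hI
  have := noMaxOrder_of_aleph0_lt_mk hI
  obtain ⟨γ', hγ'⟩ := exists_gt γ
  refine ⟨γ', fun z hz => ?_⟩
  by_contra! hlt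
  have hmem : -z ∈ ⋂₀ G := fun s hs => by
    rw [← hg hs]
    refine ⟨?_, ?_⟩
    · rw [Metric.mem_closedBall, dist_eq_norm, ← norm_neg, neg_sub, sub_neg_eq_add]
      exact hlt.le
    · refine closedSpan_mono x (fun α hα => ?_) ((closedSpan x (Ici γ')).neg_mem hz)
      exact (hγ _ (mem_image_of_mem g hs)).trans (hγ'.trans_le hα)
  rw [hGe] at hmem
  exact hmem

end Corson

/-! ### Dispersed sequences -/

section Dispersed

variable {X : Type*} [NormedAddCommGroup X] [NormedSpace ℝ X] {I : Type*}

theorem mem_closedSpan_of_mkQL_mem {x : I → X} {S : Set I} {Z : Submodule ℝ X}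
    [IsClosed (Z : Set X)] (hZ : Z ≤ closedSpan x S) {u : X}
    (hu : Z.mkQL u ∈ closedSpan (Z.mkQL ∘ x) S) : u ∈ closedSpan x S := by
  have hcomap : ((closedSpan x S).map Z.mkQ).comap Z.mkQ = closedSpan x S := by
    rw [Submodule.comap_map_mkQ, sup_eq_right.2 hZ]
  have hcl : IsClosed ((closedSpan x S).map Z.mkQ : Set (X ⧸ Z)) := by
    rw [← Z.isQuotientMap_mkQL.isClosed_preimage]
    have h := isClosed_closedSpan x S
    rw [← hcomap] at h
    exact h
  rw [← hcomap]
  exact closedSpan_le hcl (fun α hα => ⟨x α, mem_closedSpan x hα, by simp⟩) hu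

variable [LinearOrder I]

theorem iInf_closedSpan_mkQL_eq_bot {x : I → X} {Z : Submodule ℝ X} [IsClosed (Z : Set X)]
    (hZ : (⨅ γ : I, closedSpan x (Ioi γ)) = Z) :
    (⨅ γ : I, closedSpan (Z.mkQL ∘ x) (Ioi γ)) = ⊥ := by
  refine (Submodule.eq_bot_iff _).2 fun w hw => ?_
  obtain ⟨u, rfl⟩ := Z.mkQ_surjective w
  rw [Submodule.mem_iInf] at hw
  rw [← LinearMap.mem_ker, Submodule.ker_mkQ, ← hZ, Submodule.mem_iInf]
  exact fun γ => mem_closedSpan_of_mkQL_mem (hZ ▸ iInf_le _ γ) (by simpa using hw γ)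

/-- The distance from `e_α` to the span of the other vectors is at least `‖e_α‖ / 2`; the
functionals come from the Hahn–Banach theorem in the quotient by that span. -/
theorem IsMonotoneBasicSequence.exists_biorthogonal [WellFoundedLT I] [NoMaxOrder I] {e : I → X}
    (he : IsMonotoneBasicSequence e) :
    ∃ f : I → StrongDual ℝ X, IsBiorthogonalSystem e f ∧ ∀ α, ‖e α‖ * ‖f α‖ ≤ 2 := by
  let _ : SuccOrder I := SuccOrder.ofLinearWellFoundedLT I
  suffices h : ∀ α, ∃ f : StrongDual ℝ X, f (e α) = 1 ∧ (∀ β, α ≠ β → f (e β) = 0) ∧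
      ‖e α‖ * ‖f‖ ≤ 2 by
    choose f h₁ h₂ h₃ using h
    exact ⟨f, ⟨h₁, h₂⟩, h₃⟩
  intro α
  let N : Submodule ℝ X := Submodule.span ℝ (e '' {α}ᶜ)
  have hN : ∀ u ∈ N, ‖e α‖ ≤ 2 * ‖e α + u‖ := fun u hu => by
    -- Split `u = y + z` at `α`; monotonicity at `α` bounds `‖y‖`, and at its successor `‖y + e α‖`.
    have hsplit : e '' {α}ᶜ = e '' Iio α ∪ e '' Ioi α := by rw [← image_union, Iio_union_Ioi]
    simp only [N, hsplit, Submodule.span_union, Submodule.mem_sup] at hu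
    obtain ⟨y, hy, z, hz, rfl⟩ := hu
    have hy' := span_le_closedSpan e _ hy
    have hz' := span_le_closedSpan e _ hz
    have h₁ := he.2 α y hy' (e α) (mem_closedSpan e self_mem_Ici)
    have h₂ := he.2 (succ α) (y + e α) (add_mem
      (closedSpan_mono e (Iio_subset_Iio (le_succ α)) hy') (mem_closedSpan e (lt_succ α))) z
      (by rwa [Ici_succ])
    rw [one_mul] at h₁ h₂
    calc ‖e α‖ = ‖y + e α - y‖ := by rw [add_sub_cancel_left]
      _ ≤ ‖y + e α‖ + ‖y‖ := norm_sub_le _ _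
      _ ≤ 2 * ‖y + e α + z‖ := by linarith
      _ = 2 * ‖e α + (y + z)‖ := by congr 2; abel
  have hq : ‖e α‖ ≤ 2 * ‖N.mkQL (e α)‖ := by
    refine le_of_forall_pos_le_add fun ε hε => ?_
    obtain ⟨m, hm, hlt⟩ := Submodule.Quotient.norm_mk_lt (N.mkQL (e α)) (half_pos hε)
    have hmN : m - e α ∈ N := by
      rw [← Submodule.Quotient.eq, hm]
      simp
    have := hN _ hmN
    rw [add_sub_cancel] at this
    linarith
  have hpos : 0 < ‖N.mkQL (e α)‖ := by linarith [norm_pos_iff.2 (he.1 α)]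
  obtain ⟨g, hg, hge⟩ := exists_dual_vector ℝ (N.mkQL (e α)) hpos.ne'
  replace hge : g (N.mkQL (e α)) = ‖N.mkQL (e α)‖ := by simpa using hge
  refine ⟨‖N.mkQL (e α)‖⁻¹ • g.comp N.mkQL, ?_, fun β hβ => ?_, ?_⟩
  · simp only [_root_.smul_apply, ContinuousLinearMap.comp_apply, hge, smul_eq_mul]
    exact inv_mul_cancel₀ hpos.ne'
  · have : N.mkQL (e β) = 0 := by
      simpa using Submodule.subset_span (mem_image_of_mem e (by simpa using hβ.symm))
    simp only [_root_.smul_apply, ContinuousLinearMap.comp_apply, this, map_zero,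
      smul_zero]
  · have hle : ‖g.comp N.mkQL‖ ≤ 1 := by
      refine ContinuousLinearMap.opNorm_le_bound _ zero_le_one fun v => ?_
      calc ‖g (N.mkQL v)‖ ≤ 1 * ‖N.mkQL v‖ := g.le_of_opNorm_le hg.le _
        _ ≤ 1 * ‖v‖ := by
          gcongr
          exact Submodule.Quotient.norm_mk_le N v
    rw [norm_smul, norm_inv, norm_norm]
    calc ‖e α‖ * (‖N.mkQL (e α)‖⁻¹ * ‖g.comp N.mkQL‖)
        ≤ (2 * ‖N.mkQL (e α)‖) * (‖N.mkQL (e α)‖⁻¹ * 1) := by gcongr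
      _ = 2 := by field_simp

variable [WellFoundedLT I] [IsRegularCardinalOrder I]

theorem IsDispersed.exists_isCofinal_le_norm_mkQL (hI : ℵ₀ < #I) {x : I → X} (hx : IsDispersed x)
    {Z : Submodule ℝ X} [IsClosed (Z : Set X)] (hZ : (⨅ γ : I, closedSpan x (Ioi γ)) = Z) :
    ∃ δ > 0, IsCofinal {α | δ ≤ ‖Z.mkQL (x α)‖} := by
  by_contra! h
  obtain ⟨γ, hγ⟩ := exists_forall_ge_eq_zero hI (u := fun α => ‖Z.mkQL (x α)‖) fun ε hε => by
    obtain ⟨γ, hγ⟩ := not_isCofinal_iff.1 (h ε hε)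
    refine ⟨γ, fun α hα => ?_⟩
    rw [abs_norm]
    exact not_le.1 fun hle => (hγ α hle).not_ge hα
  refine (hx γ).not_ge ?_
  rw [hZ]
  refine closedSpan_le ‹_› fun α hα => ?_
  simpa using hγ α (le_of_lt hα)

/-- The functionals are those of a monotone basic subsequence in the quotient by the intersection
of the closed spans of the tails. -/
theorem IsDispersed.exists_boundedBiorthogonalSequence (hC : CorsonPropertyC X) (hI : ℵ₀ < #I)
    {x : I → X} (hx : IsDispersed x) (hx1 : ∀ α, ‖x α‖ = 1) :
    ∃ φ : I → I, StrictMono φ ∧ IsBoundedBiorthogonalSequence (x ∘ φ) := by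
  obtain ⟨Z, hZ⟩ : ∃ Z : Submodule ℝ X, (⨅ γ : I, closedSpan x (Ioi γ)) = Z := ⟨_, rfl⟩
  have : IsClosed (Z : Set X) := by
    rw [← hZ, Submodule.coe_iInf]
    exact isClosed_iInter fun γ => isClosed_closedSpan x _
  obtain ⟨δ, hδ, hcof⟩ := hx.exists_isCofinal_le_norm_mkQL hI hZ
  obtain ⟨φ, hφ, hφδ, hmono⟩ :=
    ((hC.quotient Z).isEventuallyOrthogonal hI
      (iInf_closedSpan_mkQL_eq_bot hZ)).exists_monotoneBasicSequence hI hcof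
      fun α hα => norm_pos_iff.1 (hδ.trans_le hα)
  have := noMaxOrder_of_aleph0_lt_mk hI
  obtain ⟨f, hf, hf2⟩ := hmono.exists_biorthogonal
  refine ⟨φ, hφ, fun σ => (f σ).comp Z.mkQL, ⟨hf.1, hf.2⟩, 2 / δ, fun σ => ?_⟩
  rw [Function.comp_apply, hx1, one_mul]
  have hfδ : ‖f σ‖ ≤ 2 / δ := by
    rw [le_div_iff₀' hδ]
    exact (mul_le_mul_of_nonneg_right (hφδ σ) (norm_nonneg _)).trans (hf2 σ)
  refine ContinuousLinearMap.opNorm_le_bound _ (by positivity) fun v => ?_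
  calc ‖f σ (Z.mkQL v)‖ ≤ 2 / δ * ‖Z.mkQL v‖ := (f σ).le_of_opNorm_le hfδ _
    _ ≤ 2 / δ * ‖v‖ := by
      gcongr
      exact Submodule.Quotient.norm_mk_le Z v

end Dispersed

/-! ### Plichko spaces -/

section Plichko

variable {X : Type*} [NormedAddCommGroup X] [NormedSpace ℝ X]

theorem separableSpace_of_closedSpan_eq_top {J : Type*} [Countable J] {x : J → X}
    (hx : closedSpan x univ = ⊤) : TopologicalSpace.SeparableSpace X := by
  have h : TopologicalSpace.IsSeparable (closedSpan x univ : Set X) :=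
    (countable_univ.image x).isSeparable.span.closure
  rw [hx] at h
  exact TopologicalSpace.isSeparable_univ_iff.1 h

theorem IsNormingSubspace.isEventuallyOrthogonal {J : Type*} {x : J → X}
    (hx : IsNormingSubspace 1 (countablySupportedFunctionals x)) {I : Type*} [LinearOrder I]
    [WellFoundedLT I] [IsRegularCardinalOrder I] (hI : ℵ₀ < #I) (ι : I ↪ J) :
    IsEventuallyOrthogonal (x ∘ ι) := by
  intro y r hr
  have : Nonempty I := mk_ne_zero_iff.1 (aleph0_pos.trans hI).ne'
  rcases eq_or_ne y 0 with rfl | hy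
  · exact ⟨Classical.arbitrary I, fun z _ => (hr.le.trans norm_zero.le).trans (norm_nonneg _)⟩
  have hy0 : 0 < ‖y‖ := norm_pos_iff.2 hy
  obtain ⟨f, hf, hf1, hfy⟩ := hx (‖y‖⁻¹ • y) (norm_smul_inv_norm (𝕜 := ℝ) hy) (r / ‖y‖)
    ((div_lt_one hy0).2 hr)
  have hrf : r < f y := by
    rwa [map_smul, smul_eq_mul, ← div_eq_inv_mul, div_lt_div_iff_of_pos_right hy0] at hfy
  have hcount : {α : I | f (x (ι α)) ≠ 0}.Countable :=
    Set.Countable.preimage_of_injOn (f := ι) hf ι.injective.injOn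
  obtain ⟨γ, hγ⟩ := hcount.exists_forall_lt hI
  refine ⟨γ, fun z hz => hrf.le.trans (apply_le_norm_add hf1.le (fun α hα => ?_) y hz)⟩
  by_contra hne
  exact (hγ α hne).not_ge hα

theorem IsPlichko.exists_monotoneBasicSequence {X : Type u} [NormedAddCommGroup X]
    [NormedSpace ℝ X] (hX : IsPlichko X) (hsep : ¬ TopologicalSpace.SeparableSpace X) :
    ∃ e : Set.Iio (ℵ₁ : Cardinal.{u}).ord → X, IsMonotoneBasicSequence e := by
  obtain ⟨J, x, f, ⟨hxf, htop, -⟩, hnorm⟩ := hX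
  have hJ : ℵ₁ ≤ #J := by
    rw [← not_lt, lt_aleph_one_iff]
    intro h
    have : Countable J := mk_le_aleph0_iff.1 h
    exact hsep (separableSpace_of_closedSpan_eq_top htop)
  obtain ⟨ι⟩ : Nonempty (Set.Iio (ℵ₁ : Cardinal.{u}).ord ↪ J) := by
    rw [← lift_mk_le', mk_Iio_ordinal, card_ord]
    simpa using hJ
  have := isRegular_aleph_one.{u}.isRegularCardinalOrder_Iio_ord
  have hI := aleph0_lt_mk_Iio_ord.{u} aleph0_lt_aleph_one
  obtain ⟨φ, -, -, hφ⟩ := (hnorm.isEventuallyOrthogonal hI ι).exists_monotoneBasicSequence hI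
    IsCofinal.univ fun α _ h => by
      have := hxf.1 (ι α)
      rw [show x (ι α) = 0 from h, map_zero] at this
      exact zero_ne_one this
  exact ⟨_, hφ⟩

end Plichko

theorem theorem1p1 {X : Type u} [NormedAddCommGroup X] [NormedSpace ℝ X] [CompleteSpace X] :
    (∀ (κ : Cardinal.{v}), ℵ₀ < κ → κ.IsRegular →
      ∀ x : Set.Iio κ.ord → X, (∀ α, ‖x α‖ = 1) →
        (IsWeaklyNull x →
          ∃ φ : Set.Iio κ.ord → Set.Iio κ.ord, StrictMono φ ∧
            IsMonotoneBasicSequence (x ∘ φ)) ∧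
        (CorsonPropertyC X →
          (IsDispersed x →
            ∃ φ : Set.Iio κ.ord → Set.Iio κ.ord, StrictMono φ ∧
              IsBoundedBiorthogonalSequence (x ∘ φ)) ∧
          (IsStronglyDispersed x →
            ∃ φ : Set.Iio κ.ord → Set.Iio κ.ord, StrictMono φ ∧
              IsMonotoneBasicSequence (x ∘ φ)))) ∧
    (IsPlichko X → ¬ TopologicalSpace.SeparableSpace X →
      ∃ θ : Ordinal.{u}, Order.IsSuccLimit θ ∧ ℵ₀ < θ.card ∧
        ∃ e : Set.Iio θ → X, IsMonotoneBasicSequence e) := by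
  refine ⟨fun κ hκ hreg x hx1 => ?_, fun hX hsep => ⟨(ℵ₁ : Cardinal.{u}).ord,
    isSuccLimit_ord aleph0_lt_aleph_one.le, by rw [card_ord]; exact aleph0_lt_aleph_one,
    hX.exists_monotoneBasicSequence hsep⟩⟩
  have := hreg.isRegularCardinalOrder_Iio_ord
  have hI := aleph0_lt_mk_Iio_ord hκ
  have key (hx : IsEventuallyOrthogonal x) :
      ∃ φ : Set.Iio κ.ord → Set.Iio κ.ord, StrictMono φ ∧ IsMonotoneBasicSequence (x ∘ φ) := by
    obtain ⟨φ, hφ, -, h⟩ := hx.exists_monotoneBasicSequence hI IsCofinal.univ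
      fun α _ => norm_ne_zero_iff.1 ((hx1 α).trans_ne one_ne_zero)
    exact ⟨φ, hφ, h⟩
  exact ⟨fun hx => key (hx.isEventuallyOrthogonal hI), fun hC =>
    ⟨fun hx => hx.exists_boundedBiorthogonalSequence hC hI hx1,
      fun hx => key (hC.isEventuallyOrthogonal hI hx.2)⟩⟩
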